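/- Let $d\ge 1$ be an integer, let $\mathbb{S}^d=\{x\in\mathbb{R}^{d+1}:\|x\|=1\}$, let $\sigma_d$ be the surface area measure on $\mathbb{S}^d$, and let $\omega_d=2\pi^{(d+1)/2}/\Gamma((d+1)/2)$ be its total mass. For $k\ge 0$ let $C_k^{(d-1)/2}$ denote the Gegenbauer polynomial of degree $k$ and index $(d-1)/2$ if $d\ge 2$, and the Chebyshev polynomial of the first kind $T_k$ if $d=1$. Put $\tilde C_k^{(d-1)/2}(t)=C_k^{(d-1)/2}(t)/C_k^{(d-1)/2}(1)$, and for $k\ge 1$ put $$d_{k,1}=2,\qquad d_{k,d}=\Bigl(1+\frac{2k}{d-1}\Bigr)\frac{\Gamma(d-1+k)}{\Gamma(d-1)\,k!}\quad(d\ge 2).$$ For an integer $k\ge 1$, $\mu\in\mathbb{S}^d$ and $\rho\in[-1,1]$, the spherical cardioid distribution $\mathrm{C}_k(\mu,\rho)$ is the distribution on $\mathbb{S}^d$ with density, with respect to $\sigma_d$, $$f_{\mathrm{C}_k}(x;\mu,\rho)=\frac{1}{\omega_d}\bigl\{1+\rho\,\tilde C_k^{(d-1)/2}(x^\top\mu)\bigr\}.$$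 Let $\mu_1,\mu_2\in\mathbb{S}^d$, $\rho_1,\rho_2\in[-1,1]$, let $k_1,k_2\ge 1$ be integers, and let $\delta_{k_1,k_2}$ be the Kronecker delta. Then the integrand below is integrable and $$\int_{\mathbb{S}^d} f_{\mathrm{C}_{k_1}}(x;\mu_1,\rho_1)\,f_{\mathrm{C}_{k_2}}(x;\mu_2,\rho_2)\,\sigma_d(\mathrm{d}x)=f_{\mathrm{C}_{k_1}}\Bigl(\mu_1;\mu_2,\delta_{k_1,k_2}\frac{\rho_1\rho_2}{d_{k_1,d}}\Bigr),$$ where $\delta_{k_1,k_2}\rho_1\rho_2/d_{k_1,d}\in[-1,1]$. Moreover, if $X$ and $\Xi$ are random vectors on a common probability space with values in $\mathbb{S}^d$ such that the conditional distribution of $X$ given $\Xi$ is $\mathrm{C}_{k_1}(\Xi,\rho_1)$ and $\Xi\sim\mathrm{C}_{k_2}(\mu_2,\rho_2)$, then $X\sim\mathrm{C}_{k_1}\bigl(\mu_2,\delta_{k_1,k_2}\rho_1\rho_2/d_{k_1,d}\bigr)$. -/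

import Mathlib

open MeasureTheory ProbabilityTheory

noncomputable section

namespace SphericalCardioid

/-- The unit sphere `S^d = {x ∈ ℝ^(d+1) : ‖x‖ = 1}`. -/
abbrev Sph (d : ℕ) : Type := Metric.sphere (0 : EuclideanSpace ℝ (Fin (d + 1))) 1

/-- The surface area measure `σ_d` on `S^d`. -/
def surfaceMeasure (d : ℕ) : Measure (Sph d) :=
  (volume : Measure (EuclideanSpace ℝ (Fin (d + 1)))).toSphere

/-- The surface area `ω_d = 2 π^((d+1)/2) / Γ((d+1)/2)` of `S^d`. -/
def surfaceArea (d : ℕ) : ℝ :=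
  2 * Real.pi ^ (((d : ℝ) + 1) / 2) / Real.Gamma (((d : ℝ) + 1) / 2)

/-- The Gegenbauer polynomials `C_k^lam` of index `lam`, by their three-term recurrence
`(k + 1) C_{k+1} = 2 (k + lam) x C_k - (k + 2 lam - 1) C_{k-1}`. -/
def gegenbauer (lam : ℝ) : ℕ → Polynomial ℝ
  | 0 => 1
  | 1 => Polynomial.C (2 * lam) * Polynomial.X
  | k + 2 =>
      Polynomial.C (2 * ((k : ℝ) + 1 + lam) / ((k : ℝ) + 2)) * Polynomial.X *
          gegenbauer lam (k + 1) -
        Polynomial.C (((k : ℝ) + 2 * lam) / ((k : ℝ) + 2)) * gegenbauer lam k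

/-- The polynomial `C_k^((d-1)/2)` attached to `S^d`, with the convention that `C_k^0` is the
Chebyshev polynomial of the first kind `T_k`. -/
def zonalPoly (d k : ℕ) : Polynomial ℝ :=
  if d = 1 then Polynomial.Chebyshev.T ℝ (k : ℤ) else gegenbauer (((d : ℝ) - 1) / 2) k

/-- The normalized polynomial function `x ↦ C_k^((d-1)/2)(x) / C_k^((d-1)/2)(1)`. -/
def zonalNormalized (d k : ℕ) (x : ℝ) : ℝ :=
  (zonalPoly d k).eval x / (zonalPoly d k).eval 1

/-- The number `d_{k,d}`, the dimension of the space of spherical harmonics of degree `k` on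
`S^d`: it is `2 - δ_{k,0}` for `d = 1` and
`(1 + 2k/(d-1)) Γ(d-1+k) / (Γ(d-1) k!)` for `d ≥ 2`. -/
def harmonicDim (k d : ℕ) : ℝ :=
  if d = 1 then (if k = 0 then 1 else 2)
  else (1 + 2 * (k : ℝ) / ((d : ℝ) - 1)) *
    (Real.Gamma ((d : ℝ) - 1 + k) / (Real.Gamma ((d : ℝ) - 1) * (k.factorial : ℝ)))

/-- The Kronecker delta. -/
def kronecker (k l : ℕ) : ℝ := if k = l then 1 else 0

/-- The spherical cardioid density `f_{C_k}(x; μ, ρ)` on `S^d`. -/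
def cardioidDensity (d k : ℕ) (x μ : Sph d) (ρ : ℝ) : ℝ :=
  1 / surfaceArea d *
    (1 + ρ * zonalNormalized d k
      (inner ℝ (x : EuclideanSpace ℝ (Fin (d + 1))) (μ : EuclideanSpace ℝ (Fin (d + 1)))))

/-- The spherical cardioid distribution `C_k(μ, ρ)` on `S^d`: the measure with density
`f_{C_k}(·; μ, ρ)` with respect to the surface area measure. -/
def cardioid (d k : ℕ) (μ : Sph d) (ρ : ℝ) : Measure (Sph d) :=
  (surfaceMeasure d).withDensity fun x => ENNReal.ofReal (cardioidDensity d k x μ ρ)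

theorem continuous_cardioidDensity (d k : ℕ) (ρ : ℝ) :
    Continuous fun p : Sph d × Sph d => cardioidDensity d k p.2 p.1 ρ := by
  unfold cardioidDensity zonalNormalized
  have h : Continuous fun p : Sph d × Sph d =>
      (inner ℝ (p.2 : EuclideanSpace ℝ (Fin (d + 1)))
        (p.1 : EuclideanSpace ℝ (Fin (d + 1))) : ℝ) := by fun_prop
  exact continuous_const.mul (continuous_const.add
    (continuous_const.mul (((zonalPoly d k).continuous.comp h).div_const _)))

theorem measurable_cardioid (d k : ℕ) (ρ : ℝ) :
    Measurable fun ξ : Sph d => cardioid d k ξ ρ := by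
  have : IsFiniteMeasure (surfaceMeasure d) := by unfold surfaceMeasure; infer_instance
  refine Measure.measurable_of_measurable_coe _ fun s hs => ?_
  simp only [cardioid, withDensity_apply _ hs]
  exact Measurable.lintegral_prod_right'
    (f := fun p : Sph d × Sph d => ENNReal.ofReal (cardioidDensity d k p.2 p.1 ρ))
    (continuous_cardioidDensity d k ρ).measurable.ennreal_ofReal

/-- The Markov transition `ξ ↦ C_k(ξ, ρ)` on `S^d`. -/
def cardioidKernel (d k : ℕ) (ρ : ℝ) : Kernel (Sph d) (Sph d) where
  toFun ξ := cardioid d k ξ ρ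
  measurable' := measurable_cardioid d k ρ

end SphericalCardioid

end

open SphericalCardioid

/-! Write Z_k for the zonal polynomial scaled to have value 1 at 1 (`unitZonal`), N_k for
`harmonicDim k d` and ω for the area. Everything rests on the formula ∫ Z_j(⟨x,μ⟩) Z_k(⟨x,ν⟩) dσ =
δ_{jk} (ω/N_k) Z_k(⟨μ,ν⟩). When the product of two densities is expanded, the linear terms integrate
to 0 because the degrees are positive, and this formula evaluates the remaining term.

The formula is derived without a theory of spherical harmonics. Rotation invariance of σ gives
integration by parts on the sphere (`integral_fderiv_tangential`). By the Gegenbauer equation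
(`unitZonal_ode`), zonal functions of different degrees are then eigenfunctions of a symmetric
operator with different eigenvalues, hence orthogonal. For j = k, the left side as a function of one
pole is zonal about the other and orthogonal to all Z_j with j ≠ k; since the Z_j span the
polynomials, it is a multiple of Z_k (`eq_zero_of_integral_mul_unitZonal`). The constant is found by
letting the poles coincide, where the norm of Z_k follows from the three-term recurrence
(`zonalIntegral_unitZonal_sq`).

Cauchy–Schwarz now bounds Z_k by 1 on [-1, 1], so the densities are nonnegative; it also follows
that N_k ≥ 1, so the new parameter is admissible. The law of X is a mixture whose density is, by
symmetry of the cardioid density in its two points, the same integral of a product. -/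

/-! ### Rotation invariance of the surface measure and integration by parts. -/

section SphereRotations

open Metric Set
open scoped Pointwise RealInnerProductSpace

variable {E : Type*} [NormedAddCommGroup E] [InnerProductSpace ℝ E]


/-- The action of a linear isometry on the unit sphere. -/
def sphereMap (L : E ≃ₗᵢ[ℝ] E) (x : sphere (0 : E) 1) : sphere (0 : E) 1 :=
  ⟨L x, by simp⟩

theorem continuous_sphereMap (L : E ≃ₗᵢ[ℝ] E) : Continuous (sphereMap L) := by
  unfold sphereMap
  fun_prop

/-- The infinitesimal rotation in the plane of `e` and `v`. -/
noncomputable def rotationGenerator (e v : E) : E →L[ℝ] E :=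
  (innerSL ℝ e).smulRight v - (innerSL ℝ v).smulRight e

theorem rotationGenerator_apply (e v x : E) :
    rotationGenerator e v x = ⟪e, x⟫ • v - ⟪v, x⟫ • e := by
  simp [rotationGenerator]

/-- The rotation by the angle `t` in the plane of `e` and `v`. -/
noncomputable def planeRotation (e v : E) (t : ℝ) (x : E) : E :=
  x + (Real.cos t - 1) • (⟪e, x⟫ • e + ⟪v, x⟫ • v) + Real.sin t • (⟪e, x⟫ • v - ⟪v, x⟫ • e)

theorem norm_planeRotation {e v : E} (he : ‖e‖ = 1) (hv : ‖v‖ = 1) (hev : ⟪e, v⟫ = 0) (t : ℝ)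
    (x : E) : ‖planeRotation e v t x‖ = ‖x‖ := by
  rw [← sq_eq_sq₀ (norm_nonneg _) (norm_nonneg _), ← real_inner_self_eq_norm_sq,
    ← real_inner_self_eq_norm_sq]
  have hee : ⟪e, e⟫ = 1 := by rw [real_inner_self_eq_norm_sq, he]; norm_num
  have hvv : ⟪v, v⟫ = 1 := by rw [real_inner_self_eq_norm_sq, hv]; norm_num
  have hve : ⟪v, e⟫ = 0 := by rw [real_inner_comm]; exact hev
  have hcs := Real.sin_sq_add_cos_sq t
  simp only [planeRotation, inner_add_left, inner_add_right, inner_sub_left, inner_sub_right,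
    real_inner_smul_left, real_inner_smul_right, hee, hvv, hve, hev, real_inner_comm e x,
    real_inner_comm v x]
  linear_combination (⟪e, x⟫ ^ 2 + ⟪v, x⟫ ^ 2) * hcs

theorem hasDerivAt_planeRotation (e v x : E) (t : ℝ) :
    HasDerivAt (fun s => planeRotation e v s x)
      (-Real.sin t • (⟪e, x⟫ • e + ⟪v, x⟫ • v) + Real.cos t • (⟪e, x⟫ • v - ⟪v, x⟫ • e)) t := by
  unfold planeRotation
  exact ((((Real.hasDerivAt_cos t).sub_const 1).smul_const _).const_add x).add
    ((Real.hasDerivAt_sin t).smul_const _)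

variable [FiniteDimensional ℝ E]

/-- The rotation by the angle `t` in the plane of `e` and `v`, as a linear isometry. -/
noncomputable def planeRotationIsometry {e v : E} (he : ‖e‖ = 1) (hv : ‖v‖ = 1) (hev : ⟪e, v⟫ = 0)
    (t : ℝ) : E ≃ₗᵢ[ℝ] E :=
  LinearIsometry.toLinearIsometryEquiv
    { toFun := planeRotation e v t
      map_add' := fun x y => by
        simp only [planeRotation, inner_add_right]
        module
      map_smul' := fun c x => by
        simp only [planeRotation, real_inner_smul_right, RingHom.id_apply]
        module
      norm_map' := norm_planeRotation he hv hev t } rfl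

/-- A unit vector is a member of some orthonormal basis, at a prescribed index. -/
theorem exists_orthonormalBasis_apply_eq {ι : Type*} [Fintype ι]
    (hι : Fintype.card ι = Module.finrank ℝ E) (i₀ : ι) {u : E} (hu : ‖u‖ = 1) :
    ∃ b : OrthonormalBasis ι ℝ E, b i₀ = u := by
  obtain ⟨b, hb⟩ := Orthonormal.exists_orthonormalBasis_extension_of_card_eq (𝕜 := ℝ)
    (ι := ι) hι.symm (v := fun _ => u) (s := {i₀})
    (by
      rw [orthonormal_iff_ite]
      rintro ⟨i, hi⟩ ⟨j, hj⟩
      simp only [mem_singleton_iff] at hi hj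
      subst hi hj
      simp [hu])
  exact ⟨b, hb i₀ (Set.mem_singleton _)⟩

variable [MeasurableSpace E] [BorelSpace E]

/-- The surface measure of a set is a constant times the volume of the cone over it. A linear
isometry carries cones to cones and preserves volume. -/
theorem measurePreserving_sphereMap (L : E ≃ₗᵢ[ℝ] E) :
    MeasurePreserving (sphereMap L) (volume : Measure E).toSphere
      (volume : Measure E).toSphere := by
  refine ⟨(continuous_sphereMap L).measurable, ?_⟩
  ext s hs
  rw [Measure.map_apply (continuous_sphereMap L).measurable hs,
    Measure.toSphere_apply' _ ((continuous_sphereMap L).measurable hs),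
    Measure.toSphere_apply' _ hs]
  congr 1
  have hset : L ⁻¹' (Ioo (0 : ℝ) 1 • ((↑) '' s : Set E)) =
      Ioo (0 : ℝ) 1 • ((↑) '' (sphereMap L ⁻¹' s) : Set E) := by
    ext y
    simp only [mem_preimage, Set.mem_smul, mem_image, Subtype.exists, exists_and_right,
      exists_eq_right, sphereMap]
    constructor
    · rintro ⟨r, hr, z, ⟨hz, hzs⟩, hrz⟩
      refine ⟨r, hr, L.symm z, ⟨by simpa using hz, by simpa using hzs⟩, ?_⟩
      apply L.injective
      simp [hrz]
    · rintro ⟨r, hr, z, ⟨hz, hzs⟩, rfl⟩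
      exact ⟨r, hr, L z, ⟨by simpa using hz, hzs⟩, by simp⟩
  rw [← hset]
  have hL : MeasurableEmbedding (L : E → E) := L.toHomeomorph.measurableEmbedding
  exact L.measurePreserving.measure_preimage_emb hL _

theorem integral_comp_sphereMap (L : E ≃ₗᵢ[ℝ] E) {f : sphere (0 : E) 1 → ℝ}
    (hf : Continuous f) :
    ∫ x, f (sphereMap L x) ∂(volume : Measure E).toSphere =
      ∫ x, f x ∂(volume : Measure E).toSphere := by
  have h := measurePreserving_sphereMap L
  rw [← integral_map h.measurable.aemeasurable (by rw [h.map_eq]; exact hf.aestronglyMeasurable),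
    h.map_eq]

theorem Continuous.integrable_toSphere {f : sphere (0 : E) 1 → ℝ} (hf : Continuous f) :
    Integrable f (volume : Measure E).toSphere :=
  hf.integrable_of_hasCompactSupport (HasCompactSupport.of_compactSpace f)

/-- Rotation invariance of the surface measure in infinitesimal form. -/
theorem integral_fderiv_rotationGenerator {e v : E} (he : ‖e‖ = 1) (hv : ‖v‖ = 1)
    (hev : ⟪e, v⟫ = 0) {F : E → ℝ} (hF : ContDiff ℝ 1 F) :
    ∫ x : sphere (0 : E) 1, fderiv ℝ F x (rotationGenerator e v x)
      ∂(volume : Measure E).toSphere = 0 := by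
  set σ := (volume : Measure E).toSphere
  let G : ℝ × sphere (0 : E) 1 → ℝ := fun p => fderiv ℝ F (planeRotation e v p.1 p.2)
    (-Real.sin p.1 • (⟪e, (p.2 : E)⟫ • e + ⟪v, (p.2 : E)⟫ • v) +
      Real.cos p.1 • (⟪e, (p.2 : E)⟫ • v - ⟪v, (p.2 : E)⟫ • e))
  have hG : Continuous G := by
    have h1 : Continuous (fderiv ℝ F) := hF.continuous_fderiv (by norm_num)
    have h2 : Continuous fun p : ℝ × sphere (0 : E) 1 => planeRotation e v p.1 p.2 := by
      unfold planeRotation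
      fun_prop
    exact (h1.comp h2).clm_apply (by fun_prop)
  have hrot : ∀ t : ℝ, Continuous fun x : sphere (0 : E) 1 => F (planeRotation e v t x) := by
    intro t
    refine hF.continuous.comp ?_
    unfold planeRotation
    fun_prop
  -- Compactness of [-1, 1] × sphere supplies the constant that dominates the derivative.
  obtain ⟨C, hC⟩ := ((isCompact_Icc (a := (-1 : ℝ)) (b := 1)).prod
    (isCompact_univ (X := sphere (0 : E) 1))).exists_bound_of_continuousOn hG.continuousOn
  have hd := hasDerivAt_integral_of_dominated_loc_of_deriv_le (μ := σ) (𝕜 := ℝ)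
    (F := fun t (x : sphere (0 : E) 1) => F (planeRotation e v t x))
    (F' := fun t x => G (t, x)) (x₀ := 0) (s := Icc (-1) 1) (bound := fun _ => C)
    (Icc_mem_nhds (by norm_num) (by norm_num))
    (Filter.Eventually.of_forall fun t => (hrot t).aestronglyMeasurable)
    ((hrot 0).integrable_toSphere)
    (hG.comp (by fun_prop : Continuous fun x : sphere (0 : E) 1 =>
      ((0 : ℝ), x))).aestronglyMeasurable
    (Filter.Eventually.of_forall fun x t ht => hC (t, x) ⟨ht, mem_univ _⟩)
    (integrable_const C)
    (Filter.Eventually.of_forall fun x t _ =>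
      ((hF.differentiable (by norm_num)).differentiableAt.hasFDerivAt).comp_hasDerivAt t
        (hasDerivAt_planeRotation e v x t))
  -- By invariance the integral does not depend on the angle, so its derivative at 0, which is the
  -- integral in question, vanishes.
  have hconst : (fun t => ∫ x : sphere (0 : E) 1, F (planeRotation e v t x) ∂σ) =
      fun _ => ∫ x : sphere (0 : E) 1, F x ∂σ := by
    funext t
    exact integral_comp_sphereMap (planeRotationIsometry he hv hev t)
      (f := fun x : sphere (0 : E) 1 => F x) (hF.continuous.comp continuous_subtype_val)
  have h0 := hd.2
  rw [hconst] at h0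
  have := h0.unique (hasDerivAt_const (0 : ℝ) _)
  rw [← this]
  refine integral_congr_ae (Filter.Eventually.of_forall fun x => ?_)
  simp [G, planeRotation, rotationGenerator_apply]

/-- The divergence theorem on the sphere for the field `F(x)(u - ⟨u, x⟩x)`. -/
theorem integral_fderiv_tangential {u : E} (hu : ‖u‖ = 1) {F : E → ℝ} (hF : ContDiff ℝ 1 F) :
    ∫ x : sphere (0 : E) 1, fderiv ℝ F x (u - ⟪u, (x : E)⟫ • (x : E))
      ∂(volume : Measure E).toSphere =
    ∫ x : sphere (0 : E) 1, ((Module.finrank ℝ E : ℝ) - 1) * ⟪u, (x : E)⟫ * F x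
      ∂(volume : Measure E).toSphere := by
  set σ := (volume : Measure E).toSphere
  have hn : Module.finrank ℝ E ≠ 0 := by
    intro h
    rw [Module.finrank_zero_iff] at h
    rw [Subsingleton.elim u 0, norm_zero] at hu
    norm_num at hu
  let i₀ : Fin (Module.finrank ℝ E) := ⟨0, Nat.pos_of_ne_zero hn⟩
  obtain ⟨b, hbu⟩ := exists_orthonormalBasis_apply_eq (ι := Fin (Module.finrank ℝ E))
    (by simp) i₀ hu
  have hdF : Continuous (fderiv ℝ F) := hF.continuous_fderiv (by norm_num)
  have hdiff : Differentiable ℝ F := hF.differentiable (by norm_num)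
  -- The integrand is the derivative of ⟨b i, x⟩ F(x) along the rotation in the plane of `b i` and
  -- `u`; for `b i = u` it is identically zero.
  have key : ∀ i, ∫ x : sphere (0 : E) 1,
      (⟪b i, (x : E)⟫ * fderiv ℝ F x (rotationGenerator (b i) u x) +
        F x * (⟪b i, (x : E)⟫ * ⟪b i, u⟫ - ⟪u, (x : E)⟫)) ∂σ = 0 := by
    intro i
    by_cases hi : i = i₀
    · have : ∀ x : sphere (0 : E) 1,
          ⟪b i, (x : E)⟫ * fderiv ℝ F x (rotationGenerator (b i) u x) +
          F x * (⟪b i, (x : E)⟫ * ⟪b i, u⟫ - ⟪u, (x : E)⟫) = 0 := by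
        intro x
        rw [hi, hbu, rotationGenerator_apply, real_inner_self_eq_norm_sq, hu]
        simp
      simp [this]
    · have hbi : ⟪b i, u⟫ = 0 := by
        rw [← hbu]
        exact b.orthonormal.2 hi
      have hb1 : ‖b i‖ = 1 := b.orthonormal.1 i
      have hl : ContDiff ℝ 1 fun x : E => ⟪b i, x⟫ := (innerSL ℝ (b i)).contDiff
      have h := integral_fderiv_rotationGenerator (E := E) hb1 hu hbi (hl.mul hF)
      rw [← h]
      refine integral_congr_ae (Filter.Eventually.of_forall fun x => ?_)
      have hder : HasFDerivAt (fun x : E => ⟪b i, x⟫ * F x)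
          (⟪b i, (x : E)⟫ • fderiv ℝ F x + F x • innerSL ℝ (b i)) (x : E) :=
        ((innerSL ℝ (b i)).hasFDerivAt).mul (hdiff x).hasFDerivAt
      simp only [hder.fderiv]
      simp [rotationGenerator_apply, inner_sub_right, real_inner_smul_right, hbi,
        hb1]
  have hcont : ∀ i, Continuous fun x : sphere (0 : E) 1 =>
      (⟪b i, (x : E)⟫ * fderiv ℝ F x (rotationGenerator (b i) u x) +
        F x * (⟪b i, (x : E)⟫ * ⟪b i, u⟫ - ⟪u, (x : E)⟫)) := by
    intro i
    have h1 : Continuous fun x : sphere (0 : E) 1 =>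
        fderiv ℝ F x (rotationGenerator (b i) u x) :=
      (hdF.comp continuous_subtype_val).clm_apply (by fun_prop)
    have h2 := hF.continuous
    fun_prop
  -- The rotation fields weighted by ⟨b i, x⟩ add up to the tangential field u - ⟨u, x⟩x. The
  -- remaining terms add up to (1 - n)⟨u, x⟩F(x), where n is the dimension of `E`.
  have hsum : ∀ x : sphere (0 : E) 1,
      ∑ i, (⟪b i, (x : E)⟫ * fderiv ℝ F x (rotationGenerator (b i) u x) +
        F x * (⟪b i, (x : E)⟫ * ⟪b i, u⟫ - ⟪u, (x : E)⟫)) =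
      fderiv ℝ F x (u - ⟪u, (x : E)⟫ • (x : E)) -
        ((Module.finrank ℝ E : ℝ) - 1) * ⟪u, (x : E)⟫ * F x := by
    intro x
    have hx : ⟪(x : E), (x : E)⟫ = 1 := by
      rw [real_inner_self_eq_norm_sq, norm_eq_of_mem_sphere]; norm_num
    have e1 : ∑ i, ⟪b i, (x : E)⟫ * ⟪b i, (x : E)⟫ = 1 := by
      refine Eq.trans ?_ ((b.sum_inner_mul_inner (x : E) x).trans hx)
      exact Finset.sum_congr rfl fun i _ => by rw [real_inner_comm (b i) (x : E)]
    have e2 : ∑ i, ⟪b i, (x : E)⟫ * ⟪b i, u⟫ = ⟪u, (x : E)⟫ := by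
      rw [real_inner_comm, ← b.sum_inner_mul_inner (x : E) u]
      exact Finset.sum_congr rfl fun i _ => by rw [real_inner_comm (b i) (x : E)]
    have e3 : ∑ i, ⟪b i, (x : E)⟫ • b i = (x : E) := b.sum_repr' _
    have e4 : ∑ i, ⟪b i, (x : E)⟫ • rotationGenerator (b i) u (x : E) =
        u - ⟪u, (x : E)⟫ • (x : E) := by
      simp only [rotationGenerator_apply, smul_sub, smul_smul, Finset.sum_sub_distrib,
        ← Finset.sum_smul, e1, one_smul]
      congr 1
      refine Eq.trans ?_ (congrArg (fun y => ⟪u, (x : E)⟫ • y) e3)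
      simp only [Finset.smul_sum]
      exact Finset.sum_congr rfl fun i _ => by rw [smul_smul, mul_comm]
    have e5 : ∑ i, ⟪b i, (x : E)⟫ * fderiv ℝ F x (rotationGenerator (b i) u x) =
        fderiv ℝ F x (u - ⟪u, (x : E)⟫ • (x : E)) := by
      rw [← e4, map_sum]
      simp
    rw [Finset.sum_add_distrib, e5, ← Finset.mul_sum, Finset.sum_sub_distrib, e2]
    simp only [Finset.sum_const, Finset.card_univ, Fintype.card_fin, nsmul_eq_mul]
    ring
  have hc1 : Continuous fun x : sphere (0 : E) 1 =>
      fderiv ℝ F x (u - ⟪u, (x : E)⟫ • (x : E)) :=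
    (hdF.comp continuous_subtype_val).clm_apply (by fun_prop)
  have hc2 : Continuous fun x : sphere (0 : E) 1 =>
      ((Module.finrank ℝ E : ℝ) - 1) * ⟪u, (x : E)⟫ * F x := by
    have := hF.continuous
    fun_prop
  rw [← sub_eq_zero, ← integral_sub hc1.integrable_toSphere hc2.integrable_toSphere]
  rw [← integral_congr_ae (Filter.Eventually.of_forall hsum),
    integral_finsetSum _ fun i _ => (hcont i).integrable_toSphere]
  exact Finset.sum_eq_zero fun i _ => key i

end SphereRotations

/-! ### Normalized Gegenbauer polynomials: derivative relations, differential equation, span. -/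

section NormalizedGegenbauer

open Polynomial

/-- The polynomials proportional to `zonalPoly d k` with value `1` at `1`, by their recurrence. -/
noncomputable def unitZonal (d : ℕ) : ℕ → ℝ[X]
  | 0 => 1
  | 1 => X
  | k + 2 => C (((2 * k + d + 1 : ℝ)) / (k + d)) * X * unitZonal d (k + 1) -
      C (((k : ℝ) + 1) / (k + d)) * unitZonal d k

theorem unitZonal_recurrence {d : ℕ} (hd : 1 ≤ d) (k : ℕ) :
    C ((k : ℝ) + d) * unitZonal d (k + 2) =
      C (2 * k + d + 1 : ℝ) * X * unitZonal d (k + 1) - C ((k : ℝ) + 1) * unitZonal d k := by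
  have h : (k : ℝ) + d ≠ 0 := by positivity
  rw [unitZonal, mul_sub, ← mul_assoc, ← mul_assoc, ← mul_assoc, ← C_mul, ← C_mul,
    mul_div_cancel₀ _ h, mul_div_cancel₀ _ h]

theorem unitZonal_eval_one {d : ℕ} (hd : 1 ≤ d) (k : ℕ) : (unitZonal d k).eval 1 = 1 := by
  induction k using Nat.twoStepInduction with
  | zero => simp [unitZonal]
  | one => simp [unitZonal]
  | more k h0 h1 =>
    have h : (k : ℝ) + d ≠ 0 := by positivity
    simp only [unitZonal, eval_sub, eval_mul, eval_C, eval_X, h0, h1]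
    field_simp
    ring

/-- The two relations need each other in the induction: the second at n + 1 is the first at n plus
the recurrence, while the first at n + 1 comes from differentiating the recurrence and using both at
n. -/
theorem one_sub_sq_mul_derivative_unitZonal {d : ℕ} (hd : 1 ≤ d) (n : ℕ) :
    (1 - X ^ 2) * derivative (unitZonal d (n + 1)) =
        C ((n : ℝ) + 1) * (unitZonal d n - X * unitZonal d (n + 1)) ∧
      (1 - X ^ 2) * derivative (unitZonal d n) =
        C ((n : ℝ) + d - 1) * (X * unitZonal d n - unitZonal d (n + 1)) := by
  induction n with
  | zero =>
    constructor
    · simp [unitZonal]; ring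
    · simp [unitZonal]
  | succ n ih =>
    obtain ⟨hA, hB⟩ := ih
    have hr := unitZonal_recurrence hd n
    have hne : C ((n : ℝ) + d) ≠ 0 := C_ne_zero.mpr (by positivity)
    have hr' := congrArg derivative hr
    simp only [derivative_mul, derivative_sub, derivative_C, derivative_X, zero_mul, zero_add,
      mul_one] at hr'
    simp only [C_add, C_mul, C_sub, map_one, map_ofNat, map_natCast, Nat.cast_add,
      Nat.cast_one] at *
    constructor
    · apply mul_left_cancel₀ hne
      linear_combination (1 - X ^ 2) * hr' + (2 * (n : ℝ[X]) + d + 1) * X * hA -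
        ((n : ℝ[X]) + 1) * hB + ((n : ℝ[X]) + 2) * X * hr
    · linear_combination hA + hr

/-- The Gegenbauer differential equation. -/
theorem unitZonal_ode {d : ℕ} (hd : 1 ≤ d) (k : ℕ) :
    (1 - X ^ 2) * derivative (derivative (unitZonal d k)) - C (d : ℝ) * X *
        derivative (unitZonal d k) = - C ((k : ℝ) * (k + d - 1)) * unitZonal d k := by
  cases k with
  | zero => simp [unitZonal]
  | succ n =>
    obtain ⟨hA, hB⟩ := one_sub_sq_mul_derivative_unitZonal hd n
    have hA' := congrArg derivative hA
    have hne : (1 - X ^ 2 : ℝ[X]) ≠ 0 := by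
      intro h
      have := congrArg (Polynomial.eval 0) h
      simp at this
    simp only [derivative_mul, derivative_sub, derivative_C, derivative_X, zero_mul, zero_add,
      derivative_one, derivative_X_pow, one_mul] at hA'
    -- After one more factor 1 - X², both first derivatives in the differentiated relation can be
    -- eliminated by the first-order relations.
    apply mul_left_cancel₀ hne
    simp only [C_add, C_mul, C_sub, map_one, map_ofNat, map_natCast, Nat.cast_add,
      Nat.cast_one, Nat.cast_ofNat] at *
    norm_num at hA'
    linear_combination (1 - X ^ 2) * hA' + ((n : ℝ[X]) + 1) * hB + ((1 - (n : ℝ[X])) * X -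
      d * X) * hA

theorem exists_zonalPoly_eq_C_mul_unitZonal {d : ℕ} (hd : 1 ≤ d) (k : ℕ) :
    ∃ c : ℝ, c ≠ 0 ∧ zonalPoly d k = C c * unitZonal d k := by
  unfold zonalPoly
  split_ifs with h
  · subst h
    refine ⟨1, one_ne_zero, ?_⟩
    rw [map_one, one_mul]
    induction k using Nat.twoStepInduction with
    | zero => simp [unitZonal]
    | one => simp [unitZonal]
    | more k h0 h1 =>
      have h : (k : ℝ) + 1 ≠ 0 := by positivity
      have e1 : (2 * k + 1 + 1 : ℝ) / (k + 1) = 2 := by field_simp; ring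
      push_cast at h0 h1 ⊢
      rw [Chebyshev.T_add_two, h0, h1, unitZonal]
      push_cast
      rw [e1, div_self h]
      simp [← map_ofNat C 2]
  · have hd2 : 2 ≤ d := by omega
    have hm : (0 : ℝ) < (d : ℝ) - 1 := by
      have : (2 : ℝ) ≤ d := by exact_mod_cast hd2
      linarith
    -- `c k` is the value (d-1)(d)⋯(d+k-2)/k! of the Gegenbauer polynomial at 1, given by its
    -- successive ratios.
    obtain ⟨c, hc0, hc⟩ : ∃ c : ℕ → ℝ, (c 0 = 1) ∧
        ∀ k, c (k + 1) = c k * ((k + d - 1) / (k + 1)) :=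
      ⟨fun k => Nat.rec 1 (fun k r => r * ((k + d - 1) / (k + 1))) k, rfl, fun _ => rfl⟩
    refine ⟨c k, ?_, ?_⟩
    · induction k with
      | zero => simp [hc0]
      | succ k ih =>
        rw [hc]
        have : (0 : ℝ) < k + d - 1 := by have : (0 : ℝ) ≤ k := by positivity
                                         linarith
        positivity
    · induction k using Nat.twoStepInduction with
      | zero => simp [gegenbauer, unitZonal, hc0]
      | one =>
        have e : 2 * (((d : ℝ) - 1) / 2) = c 1 := by
          have := hc 0
          simp only [zero_add, hc0, one_mul, Nat.cast_zero, div_one] at this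
          rw [this]; ring
        rw [gegenbauer, unitZonal, e]
      | more k h0 h1 =>
        have h : (k : ℝ) + d ≠ 0 := by positivity
        have hk2 : (k : ℝ) + 2 ≠ 0 := by positivity
        have hk1 : (k : ℝ) + 1 ≠ 0 := by positivity
        have h3 : c (k + 2) = c (k + 1) * ((k + d) / (k + 2)) := by
          rw [hc (k + 1)]; push_cast; ring
        have e1 : 2 * ((k : ℝ) + 1 + ((d : ℝ) - 1) / 2) / (k + 2) * c (k + 1) =
            c (k + 2) * ((2 * k + d + 1) / (k + d)) := by
          rw [h3]; field_simp; ring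
        have e2 : ((k : ℝ) + 2 * (((d : ℝ) - 1) / 2)) / (k + 2) * c k =
            c (k + 2) * ((k + 1) / (k + d)) := by
          rw [h3, hc]; field_simp; ring
        rw [gegenbauer, h0, h1, unitZonal]
        have e1' := congrArg C e1
        have e2' := congrArg C e2
        rw [C_mul, C_mul] at e1' e2'
        linear_combination X * unitZonal d (k + 1) * e1' - unitZonal d k * e2'

theorem zonalNormalized_eq {d : ℕ} (hd : 1 ≤ d) (k : ℕ) (x : ℝ) :
    zonalNormalized d k x = (unitZonal d k).eval x := by
  obtain ⟨c, hc, h⟩ := exists_zonalPoly_eq_C_mul_unitZonal hd k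
  rw [zonalNormalized, h, eval_mul, eval_mul, eval_C, eval_C, unitZonal_eval_one hd, mul_one,
    mul_div_cancel_left₀ _ hc]

/-- The span contains 1 and is stable under multiplication by X, because the recurrence can be
solved for X times a member of the family. -/
theorem span_unitZonal {d : ℕ} (hd : 1 ≤ d) :
    Submodule.span ℝ (Set.range (unitZonal d)) = ⊤ := by
  set S := Submodule.span ℝ (Set.range (unitZonal d))
  have hmem : ∀ k, unitZonal d k ∈ S := fun k => Submodule.subset_span ⟨k, rfl⟩
  have hX : ∀ p ∈ S, X * p ∈ S := by
    intro p hp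
    induction hp using Submodule.span_induction with
    | zero => simp
    | add p q _ _ hp hq => rw [mul_add]; exact S.add_mem hp hq
    | smul c p _ hp => rw [mul_smul_comm]; exact S.smul_mem c hp
    | mem p hp =>
      obtain ⟨k, rfl⟩ := hp
      cases k with
      | zero => simpa [unitZonal] using hmem 1
      | succ k =>
        have h : (2 * k + d + 1 : ℝ) ≠ 0 := by positivity
        have hr := unitZonal_recurrence hd k
        have : X * unitZonal d (k + 1) = (2 * k + d + 1 : ℝ)⁻¹ •
            (((k : ℝ) + d) • unitZonal d (k + 2) + ((k : ℝ) + 1) • unitZonal d k) := by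
          simp only [← C_mul', hr]
          rw [sub_add_cancel, ← mul_assoc, ← mul_assoc, ← C_mul, inv_mul_cancel₀ h]
          simp
        rw [this]
        exact S.smul_mem _ (S.add_mem (S.smul_mem _ (hmem _)) (S.smul_mem _ (hmem _)))
  rw [eq_top_iff]
  intro p _
  induction p using Polynomial.induction_on' with
  | add p q hp hq => exact S.add_mem (hp trivial) (hq trivial)
  | monomial n a =>
    rw [← C_mul_X_pow_eq_monomial, ← smul_eq_C_mul]
    refine S.smul_mem a ?_
    clear * - hX hmem
    induction n with
    | zero => simpa [unitZonal] using hmem 0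
    | succ n ih => rw [pow_succ']; exact hX _ ih

end NormalizedGegenbauer

/-! ### Green's formula and orthogonality of zonal functions. -/

section ZonalFunctions

open Polynomial
open scoped RealInnerProductSpace

variable {d : ℕ}

theorem continuous_eval_inner_left (p : ℝ[X]) (μ : Sph d) :
    Continuous fun x : Sph d => p.eval ⟪(x : EuclideanSpace ℝ (Fin (d + 1))), μ⟫ :=
  p.continuous.comp (by fun_prop)

instance : IsFiniteMeasure (surfaceMeasure d) := by
  unfold surfaceMeasure
  infer_instance

instance : (surfaceMeasure d).IsOpenPosMeasure := by
  unfold surfaceMeasure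
  infer_instance

theorem inner_self_sphere (x : Sph d) : ⟪(x : EuclideanSpace ℝ (Fin (d + 1))), x⟫ = 1 := by
  rw [real_inner_self_eq_norm_sq, norm_eq_of_mem_sphere]
  norm_num

theorem abs_inner_sphere_le_one (x y : Sph d) :
    |⟪(x : EuclideanSpace ℝ (Fin (d + 1))), y⟫| ≤ 1 := by
  simpa using abs_real_inner_le_norm (x : EuclideanSpace ℝ (Fin (d + 1))) y

/-- The total mass is d + 1 times the volume of the unit ball; Γ(s + 1) = sΓ(s) absorbs the factor.
-/
theorem surfaceMeasure_real_univ : (surfaceMeasure d).real Set.univ = surfaceArea d := by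
  have h : (0 : ℝ) < ((d : ℝ) + 1) / 2 := by positivity
  have hG := Real.Gamma_pos_of_pos h
  rw [surfaceMeasure, Measure.toSphere_real_apply_univ, measureReal_def,
    EuclideanSpace.volume_ball, surfaceArea, finrank_euclideanSpace, Fintype.card_fin]
  push_cast
  rw [Real.Gamma_add_one h.ne', ENNReal.ofReal_one, one_pow, one_mul,
    ENNReal.toReal_ofReal (by positivity), Real.sqrt_eq_rpow, ← Real.rpow_natCast,
    ← Real.rpow_mul Real.pi_pos.le]
  push_cast
  rw [show 1 / 2 * ((d : ℝ) + 1) = ((d : ℝ) + 1) / 2 by ring]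
  field_simp

theorem surfaceArea_pos : 0 < surfaceArea d := by
  have h : (0 : ℝ) < ((d : ℝ) + 1) / 2 := by positivity
  have hG := Real.Gamma_pos_of_pos h
  rw [surfaceArea]
  positivity

theorem Continuous.integrable_surfaceMeasure {f : Sph d → ℝ} (hf : Continuous f) :
    Integrable f (surfaceMeasure d) :=
  hf.integrable_toSphere

/-- Green's formula for two zonal functions. -/
theorem integral_zonal_laplacian_mul (p q : ℝ[X]) (μ ν : Sph d) :
    ∫ x : Sph d, ((1 - X ^ 2) * derivative (derivative p) - C (d : ℝ) * X * derivative p).eval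
        ⟪(x : EuclideanSpace ℝ (Fin (d + 1))), μ⟫ *
        q.eval ⟪(x : EuclideanSpace ℝ (Fin (d + 1))), ν⟫ ∂surfaceMeasure d =
      -∫ x : Sph d, (derivative p).eval ⟪(x : EuclideanSpace ℝ (Fin (d + 1))), μ⟫ *
        (derivative q).eval ⟪(x : EuclideanSpace ℝ (Fin (d + 1))), ν⟫ *
        (⟪(μ : EuclideanSpace ℝ (Fin (d + 1))), ν⟫ -
          ⟪(x : EuclideanSpace ℝ (Fin (d + 1))), μ⟫ * ⟪(x : EuclideanSpace ℝ (Fin (d + 1))), ν⟫)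
        ∂surfaceMeasure d := by
  have hμ : ‖(μ : EuclideanSpace ℝ (Fin (d + 1)))‖ = 1 := norm_eq_of_mem_sphere μ
  -- The tangential gradient of p(⟨x, μ⟩) is p'(⟨x, μ⟩)(μ - ⟨μ, x⟩x), so the divergence theorem is
  -- applied with direction `μ` and the scalar factor p'q.
  let F : EuclideanSpace ℝ (Fin (d + 1)) → ℝ := fun y =>
    (derivative p).eval ⟪y, (μ : EuclideanSpace ℝ (Fin (d + 1)))⟫ *
      q.eval ⟪y, (ν : EuclideanSpace ℝ (Fin (d + 1)))⟫
  have hsm (r : ℝ[X]) (w : EuclideanSpace ℝ (Fin (d + 1))) :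
      ContDiff ℝ 1 fun y => r.eval ⟪y, w⟫ := by
    have := (r.contDiff_aeval (𝕜 := ℝ) 1).comp
      ((contDiff_id (𝕜 := ℝ) (E := EuclideanSpace ℝ (Fin (d + 1)))).inner ℝ (contDiff_const (c := w)))
    simpa [Function.comp_def, coe_aeval_eq_eval] using this
  have hdv (r : ℝ[X]) (w y : EuclideanSpace ℝ (Fin (d + 1))) :
      HasFDerivAt (fun y => r.eval ⟪y, w⟫) ((derivative r).eval ⟪y, w⟫ • innerSL ℝ w) y := by
    have h1 : HasFDerivAt (fun y : EuclideanSpace ℝ (Fin (d + 1)) => ⟪y, w⟫) (innerSL ℝ w) y := by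
      simp_rw [real_inner_comm w]
      exact (innerSL ℝ w).hasFDerivAt
    exact (r.hasDerivAt ⟪y, w⟫).comp_hasFDerivAt y h1
  have h := integral_fderiv_tangential hμ (F := F) ((hsm _ _).mul (hsm _ _))
  have hF (y : EuclideanSpace ℝ (Fin (d + 1))) := ((hdv (derivative p) μ y).mul (hdv q ν y)).fderiv
  have hc1 : Continuous fun x : Sph d =>
      ((1 - X ^ 2) * derivative (derivative p) - C (d : ℝ) * X * derivative p).eval
        ⟪(x : EuclideanSpace ℝ (Fin (d + 1))), μ⟫ *
        q.eval ⟪(x : EuclideanSpace ℝ (Fin (d + 1))), ν⟫ :=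
    (continuous_eval_inner_left _ μ).mul (continuous_eval_inner_left q ν)
  have hc2 : Continuous fun x : Sph d =>
      (derivative p).eval ⟪(x : EuclideanSpace ℝ (Fin (d + 1))), μ⟫ *
        (derivative q).eval ⟪(x : EuclideanSpace ℝ (Fin (d + 1))), ν⟫ *
        (⟪(μ : EuclideanSpace ℝ (Fin (d + 1))), ν⟫ -
          ⟪(x : EuclideanSpace ℝ (Fin (d + 1))), μ⟫ *
            ⟪(x : EuclideanSpace ℝ (Fin (d + 1))), ν⟫) :=
    ((continuous_eval_inner_left _ μ).mul (continuous_eval_inner_left _ ν)).mul (by fun_prop)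
  have hc3 : Continuous fun x : Sph d => (d : ℝ) * ⟪(μ : EuclideanSpace ℝ (Fin (d + 1))), x⟫ * F x :=
    Continuous.mul (by fun_prop)
      ((continuous_eval_inner_left _ μ).mul (continuous_eval_inner_left _ ν))
  rw [eq_neg_iff_add_eq_zero, ← integral_add hc1.integrable_surfaceMeasure
    hc2.integrable_surfaceMeasure]
  rw [finrank_euclideanSpace, Fintype.card_fin] at h
  push_cast at h
  simp only [add_sub_cancel_right] at h
  change ∫ x : Sph d, _ ∂surfaceMeasure d = ∫ x : Sph d, _ ∂surfaceMeasure d at h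
  rw [← sub_eq_zero] at h
  have hpt : ∀ x : Sph d, fderiv ℝ F (x : EuclideanSpace ℝ (Fin (d + 1)))
      (μ - ⟪(μ : EuclideanSpace ℝ (Fin (d + 1))), x⟫ • (x : EuclideanSpace ℝ (Fin (d + 1)))) =
      ((1 - X ^ 2) * derivative (derivative p) - C (d : ℝ) * X * derivative p).eval
        ⟪(x : EuclideanSpace ℝ (Fin (d + 1))), μ⟫ *
        q.eval ⟪(x : EuclideanSpace ℝ (Fin (d + 1))), ν⟫ +
      (derivative p).eval ⟪(x : EuclideanSpace ℝ (Fin (d + 1))), μ⟫ *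
        (derivative q).eval ⟪(x : EuclideanSpace ℝ (Fin (d + 1))), ν⟫ *
        (⟪(μ : EuclideanSpace ℝ (Fin (d + 1))), ν⟫ -
          ⟪(x : EuclideanSpace ℝ (Fin (d + 1))), μ⟫ *
            ⟪(x : EuclideanSpace ℝ (Fin (d + 1))), ν⟫) +
      (d : ℝ) * ⟪(μ : EuclideanSpace ℝ (Fin (d + 1))), x⟫ * F x := by
    intro x
    have := hF x
    rw [show fderiv ℝ F (x : EuclideanSpace ℝ (Fin (d + 1))) = _ from this]
    simp only [F, add_apply, smul_apply, innerSL_apply_apply,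
      inner_sub_right, real_inner_smul_right, inner_self_sphere, smul_eq_mul, eval_sub, eval_mul,
      eval_one, eval_pow, eval_X, eval_C, real_inner_comm (x : EuclideanSpace ℝ (Fin (d + 1))) μ,
      real_inner_comm (x : EuclideanSpace ℝ (Fin (d + 1))) ν,
      real_inner_comm (μ : EuclideanSpace ℝ (Fin (d + 1))) ν]
    ring
  rw [integral_congr_ae (Filter.Eventually.of_forall hpt),
    integral_add (hc1.fun_add hc2).integrable_surfaceMeasure hc3.integrable_surfaceMeasure,
    add_sub_cancel_right] at h
  exact h

/-- Zonal functions of different degrees, with arbitrary poles, are orthogonal. -/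
theorem integral_unitZonal_mul_unitZonal_of_ne (hd : 1 ≤ d) {j k : ℕ} (hjk : j ≠ k)
    (μ ν : Sph d) :
    ∫ x : Sph d, (unitZonal d j).eval ⟪(x : EuclideanSpace ℝ (Fin (d + 1))), μ⟫ *
      (unitZonal d k).eval ⟪(x : EuclideanSpace ℝ (Fin (d + 1))), ν⟫ ∂surfaceMeasure d = 0 := by
  have h1 := integral_zonal_laplacian_mul (unitZonal d j) (unitZonal d k) μ ν
  have h2 := integral_zonal_laplacian_mul (unitZonal d k) (unitZonal d j) ν μ
  rw [unitZonal_ode hd] at h1 h2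
  -- The gradient term is symmetric under exchanging the two zonal functions, so the two eigenvalue
  -- identities can be equated.
  have h3 : ∫ x : Sph d, (derivative (unitZonal d j)).eval
        ⟪(x : EuclideanSpace ℝ (Fin (d + 1))), μ⟫ *
        (derivative (unitZonal d k)).eval ⟪(x : EuclideanSpace ℝ (Fin (d + 1))), ν⟫ *
        (⟪(μ : EuclideanSpace ℝ (Fin (d + 1))), ν⟫ -
          ⟪(x : EuclideanSpace ℝ (Fin (d + 1))), μ⟫ *
            ⟪(x : EuclideanSpace ℝ (Fin (d + 1))), ν⟫) ∂surfaceMeasure d =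
      ∫ x : Sph d, (derivative (unitZonal d k)).eval
        ⟪(x : EuclideanSpace ℝ (Fin (d + 1))), ν⟫ *
        (derivative (unitZonal d j)).eval ⟪(x : EuclideanSpace ℝ (Fin (d + 1))), μ⟫ *
        (⟪(ν : EuclideanSpace ℝ (Fin (d + 1))), μ⟫ -
          ⟪(x : EuclideanSpace ℝ (Fin (d + 1))), ν⟫ *
            ⟪(x : EuclideanSpace ℝ (Fin (d + 1))), μ⟫) ∂surfaceMeasure d := by
    refine integral_congr_ae (Filter.Eventually.of_forall fun x => ?_)
    simp only [real_inner_comm (μ : EuclideanSpace ℝ (Fin (d + 1))) ν]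
    ring
  rw [h3, ← h2] at h1
  simp only [eval_mul, eval_neg, eval_C, neg_mul, mul_assoc, integral_neg,
    integral_const_mul] at h1
  simp only [mul_comm (eval _ (unitZonal d k))] at h1
  -- The eigenvalues k(k + d - 1) are pairwise distinct.
  have hne : (j : ℝ) * (j + d - 1) - k * (k + d - 1) ≠ 0 := by
    have hd' : (1 : ℝ) ≤ d := by exact_mod_cast hd
    have e : (j : ℝ) * (j + d - 1) - k * (k + d - 1) = (j - k) * (j + k + d - 1) := by ring
    rw [e]
    refine mul_ne_zero (sub_ne_zero.mpr (by exact_mod_cast hjk)) ?_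
    have : (1 : ℝ) ≤ (j : ℝ) + k := by
      have : 1 ≤ j + k := by omega
      exact_mod_cast this
    linarith
  refine (mul_eq_zero.mp ?_).resolve_left hne
  linear_combination -h1

end ZonalFunctions

/-! ### Norms, reproducing property and the bounds that follow. -/

section ReproducingKernel

open Polynomial
open scoped RealInnerProductSpace

variable {d : ℕ}

/-- The integral of the zonal function `x ↦ p(⟨x, μ⟩)` as a linear functional of `p`. -/
noncomputable def zonalIntegral (μ : Sph d) : ℝ[X] →ₗ[ℝ] ℝ where
  toFun p := ∫ x : Sph d, p.eval ⟪(x : EuclideanSpace ℝ (Fin (d + 1))), μ⟫ ∂surfaceMeasure d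
  map_add' p q := by
    simp only [eval_add]
    exact integral_add (continuous_eval_inner_left p μ).integrable_surfaceMeasure
      (continuous_eval_inner_left q μ).integrable_surfaceMeasure
  map_smul' c p := by
    simp only [eval_smul, smul_eq_mul, integral_const_mul, RingHom.id_apply]

theorem zonalIntegral_apply (μ : Sph d) (p : ℝ[X]) : zonalIntegral μ p =
    ∫ x : Sph d, p.eval ⟪(x : EuclideanSpace ℝ (Fin (d + 1))), μ⟫ ∂surfaceMeasure d := rfl

theorem zonalIntegral_unitZonal_mul_of_ne (hd : 1 ≤ d) {j k : ℕ} (hjk : j ≠ k) (μ : Sph d) :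
    zonalIntegral μ (unitZonal d j * unitZonal d k) = 0 := by
  simp only [zonalIntegral_apply, eval_mul]
  exact integral_unitZonal_mul_unitZonal_of_ne hd hjk μ μ

theorem zonalIntegral_recurrence (hd : 1 ≤ d) (μ : Sph d) (k : ℕ) (p : ℝ[X]) :
    ((k : ℝ) + d) * zonalIntegral μ (unitZonal d (k + 2) * p) =
      (2 * k + d + 1 : ℝ) * zonalIntegral μ (X * unitZonal d (k + 1) * p) -
        ((k : ℝ) + 1) * zonalIntegral μ (unitZonal d k * p) := by
  simp only [← smul_eq_mul (a := (_ : ℝ)), ← map_smul, ← map_sub]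
  congr 1
  simp only [smul_eq_C_mul]
  linear_combination p * unitZonal_recurrence hd k

theorem zonalIntegral_one (μ : Sph d) : zonalIntegral μ 1 = surfaceArea d := by
  simp [zonalIntegral_apply, surfaceMeasure_real_univ]

theorem harmonicDim_pos (hd : 1 ≤ d) (k : ℕ) : 0 < harmonicDim k d := by
  unfold harmonicDim
  by_cases h : d = 1
  · rw [if_pos h]
    split_ifs
    · exact one_pos
    · exact two_pos
  · rw [if_neg h]
    have hm : (0 : ℝ) < (d : ℝ) - 1 := by
      have : (2 : ℝ) ≤ d := by exact_mod_cast (by omega : 2 ≤ d)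
      linarith
    have h1 := Real.Gamma_pos_of_pos hm
    have h2 := Real.Gamma_pos_of_pos (add_pos_of_pos_of_nonneg hm (Nat.cast_nonneg k))
    positivity

theorem harmonicDim_zero (hd : 1 ≤ d) : harmonicDim 0 d = 1 := by
  unfold harmonicDim
  by_cases h : d = 1
  · simp [h]
  · rw [if_neg h]
    have hm : (0 : ℝ) < (d : ℝ) - 1 := by
      have : (2 : ℝ) ≤ d := by exact_mod_cast (by omega : 2 ≤ d)
      linarith
    simp [(Real.Gamma_pos_of_pos hm).ne']

theorem harmonicDim_one (hd : 1 ≤ d) : harmonicDim 1 d = d + 1 := by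
  unfold harmonicDim
  by_cases h : d = 1
  · simp [h]; norm_num
  · rw [if_neg h]
    have hm : (0 : ℝ) < (d : ℝ) - 1 := by
      have : (2 : ℝ) ≤ d := by exact_mod_cast (by omega : 2 ≤ d)
      linarith
    have h1 := (Real.Gamma_pos_of_pos hm).ne'
    have h2 := hm.ne'
    push_cast
    rw [Real.Gamma_add_one hm.ne', Nat.factorial_one]
    field_simp
    push_cast
    ring

/-- The ratio is taken from degree 1 on because for `d = 1` the dimension is exceptional in degree
0. -/
theorem harmonicDim_add_two (hd : 1 ≤ d) (k : ℕ) :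
    ((k : ℝ) + 2) * (2 * k + d + 1) * harmonicDim (k + 2) d =
      (k + d) * (2 * k + d + 3) * harmonicDim (k + 1) d := by
  unfold harmonicDim
  by_cases h : d = 1
  · subst h; simp; ring
  · rw [if_neg h, if_neg h]
    have hm : (0 : ℝ) < (d : ℝ) - 1 := by
      have : (2 : ℝ) ≤ d := by exact_mod_cast (by omega : 2 ≤ d)
      linarith
    have h1 := (Real.Gamma_pos_of_pos hm).ne'
    have h2 := hm.ne'
    have h3 : (d : ℝ) - 1 + (k + 1 : ℕ) ≠ 0 := by positivity
    have h4 := Real.Gamma_add_one h3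
    rw [show (d : ℝ) - 1 + (k + 1 : ℕ) + 1 = (d : ℝ) - 1 + (k + 2 : ℕ) by push_cast; ring] at h4
    rw [h4, Nat.factorial_succ (k + 1)]
    have h5 : ((k + 1).factorial : ℝ) ≠ 0 := by positivity
    push_cast
    field_simp
    ring

/-- Testing two consecutive recurrences against Z_{k+2} and Z_{k+1} leaves, by orthogonality, the
same moment of X Z_{k+1} Z_{k+2}. Eliminating it gives the ratio of consecutive squared norms, which
is the inverse ratio of the dimensions. -/
theorem zonalIntegral_unitZonal_sq (hd : 1 ≤ d) (μ : Sph d) (k : ℕ) :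
    zonalIntegral μ (unitZonal d k * unitZonal d k) = surfaceArea d / harmonicDim k d := by
  rw [eq_div_iff (harmonicDim_pos hd k).ne']
  have ho {i j : ℕ} (hij : i ≠ j) := zonalIntegral_unitZonal_mul_of_ne hd hij μ
  induction k using Nat.twoStepInduction with
  | zero => rw [harmonicDim_zero hd]; simp [unitZonal, zonalIntegral_one]
  | one =>
    have h := zonalIntegral_recurrence hd μ 0 (unitZonal d 0)
    have e : X * unitZonal d (0 + 1) * unitZonal d 0 = unitZonal d 1 * unitZonal d 1 := by
      simp [unitZonal]
    have e0 : zonalIntegral μ (unitZonal d 0 * unitZonal d 0) = surfaceArea d := by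
      simp [unitZonal, zonalIntegral_one]
    rw [ho (by omega), e, e0] at h
    rw [harmonicDim_one hd]
    push_cast at h
    linarith
  | more k _ h1 =>
    have hA := zonalIntegral_recurrence hd μ k (unitZonal d (k + 2))
    have hB := zonalIntegral_recurrence hd μ (k + 1) (unitZonal d (k + 1))
    have e : X * unitZonal d (k + 1 + 1) * unitZonal d (k + 1) =
        X * unitZonal d (k + 1) * unitZonal d (k + 2) := by ring
    rw [ho (i := k) (by omega), mul_zero, sub_zero] at hA
    rw [ho (i := k + 1 + 2) (by omega), e] at hB
    have hdim := harmonicDim_add_two hd k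
    have hne : ((k : ℝ) + d) * (2 * k + d + 3) ≠ 0 := by positivity
    apply mul_left_cancel₀ hne
    push_cast at hB
    linear_combination (2 * (k : ℝ) + d + 3) * harmonicDim (k + 2) d * hA -
      (2 * (k : ℝ) + d + 1) * harmonicDim (k + 2) d * hB +
      zonalIntegral μ (unitZonal d (k + 1) * unitZonal d (k + 1)) * hdim +
      ((k : ℝ) + d) * (2 * k + d + 3) * h1

theorem exists_unit_inner_eq_zero (hd : 1 ≤ d) (μ : Sph d) :
    ∃ e : EuclideanSpace ℝ (Fin (d + 1)), ‖e‖ = 1 ∧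
      ⟪e, (μ : EuclideanSpace ℝ (Fin (d + 1)))⟫ = 0 := by
  obtain ⟨b, hb⟩ := exists_orthonormalBasis_apply_eq (E := EuclideanSpace ℝ (Fin (d + 1)))
    (ι := Fin (d + 1)) (by simp) 0 (norm_eq_of_mem_sphere μ)
  have hne : (⟨1, by omega⟩ : Fin (d + 1)) ≠ 0 := by simp [Fin.ext_iff]
  refine ⟨b ⟨1, by omega⟩, b.orthonormal.1 _, ?_⟩
  rw [← hb]
  exact b.orthonormal.2 hne

/-- A continuous zonal function orthogonal to all the zonal polynomials with the same pole is
zero. -/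
theorem eq_zero_of_integral_mul_unitZonal (hd : 1 ≤ d) (μ : Sph d) {F : Sph d → ℝ} {g : ℝ → ℝ}
    (hF : Continuous F) (hg : Continuous g)
    (hFg : ∀ x : Sph d, F x = g ⟪(x : EuclideanSpace ℝ (Fin (d + 1))), μ⟫)
    (h : ∀ j, ∫ x : Sph d, F x * (unitZonal d j).eval
      ⟪(x : EuclideanSpace ℝ (Fin (d + 1))), μ⟫ ∂surfaceMeasure d = 0) (x : Sph d) : F x = 0 := by
  have hint (p : ℝ[X]) : Integrable (fun x : Sph d => F x * p.eval
      ⟪(x : EuclideanSpace ℝ (Fin (d + 1))), μ⟫) (surfaceMeasure d) :=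
    (hF.fun_mul (continuous_eval_inner_left p μ)).integrable_surfaceMeasure
  have hp (p : ℝ[X]) : ∫ x : Sph d, F x * p.eval
      ⟪(x : EuclideanSpace ℝ (Fin (d + 1))), μ⟫ ∂surfaceMeasure d = 0 := by
    have hmem : p ∈ Submodule.span ℝ (Set.range (unitZonal d)) := by
      rw [span_unitZonal hd]; trivial
    induction hmem using Submodule.span_induction with
    | zero => simp
    | mem p hp => obtain ⟨j, rfl⟩ := hp; exact h j
    | add p q _ _ hp hq =>
      simp only [eval_add, mul_add]
      rw [integral_add (hint p) (hint q), hp, hq, add_zero]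
    | smul c p _ hp =>
      simp only [eval_smul, smul_eq_mul, mul_left_comm _ c, integral_const_mul, hp, mul_zero]
  have hF2 : Continuous fun x => F x * F x := hF.fun_mul hF
  -- Weierstrass: subtracting from one factor F a polynomial within ε of `g` on [-1, 1] does not
  -- change the integral.
  have hle : ∀ ε > 0, ∫ x, F x * F x ∂surfaceMeasure d ≤
      ε * ∫ x, |F x| ∂surfaceMeasure d := by
    intro ε hε
    obtain ⟨p, hpε⟩ := exists_polynomial_near_of_continuousOn (-1) 1 g hg.continuousOn ε hε
    have h1 : ∫ x, F x * F x ∂surfaceMeasure d = ∫ x : Sph d, (F x * F x - F x * p.eval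
        ⟪(x : EuclideanSpace ℝ (Fin (d + 1))), μ⟫) ∂surfaceMeasure d := by
      rw [integral_sub hF2.integrable_surfaceMeasure (hint p), hp p, sub_zero]
    rw [h1, ← integral_const_mul]
    refine integral_mono (hF2.integrable_surfaceMeasure.sub (hint p))
      ((continuous_const.fun_mul hF.abs).integrable_surfaceMeasure) fun x => ?_
    have h2 := hpε _ (abs_le.mp (abs_inner_sphere_le_one x μ))
    rw [← hFg, abs_sub_comm] at h2
    dsimp only
    rw [← mul_sub, mul_comm ε]
    calc _ ≤ |F x * (F x - p.eval ⟪(x : EuclideanSpace ℝ (Fin (d + 1))), μ⟫)| := le_abs_self _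
      _ = |F x| * |F x - p.eval ⟪(x : EuclideanSpace ℝ (Fin (d + 1))), μ⟫| := abs_mul _ _
      _ ≤ |F x| * ε := mul_le_mul_of_nonneg_left h2.le (abs_nonneg _)
  have hM : 0 ≤ ∫ x, |F x| ∂surfaceMeasure d := integral_nonneg fun x => abs_nonneg _
  have hle0 : ∫ x, F x * F x ∂surfaceMeasure d ≤ 0 := by
    refine le_of_forall_pos_le_add fun ε hε => ?_
    have := hle (ε / ((∫ x, |F x| ∂surfaceMeasure d) + 1)) (by positivity)
    refine this.trans ?_
    rw [zero_add, div_mul_eq_mul_div, div_le_iff₀ (by positivity)]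
    nlinarith
  by_contra hx
  have := hF2.integral_pos_of_hasCompactSupport_nonneg_nonzero (μ := surfaceMeasure d)
    (HasCompactSupport.of_compactSpace _) (fun x => mul_self_nonneg (F x))
    (x := x) (mul_self_ne_zero.mpr hx)
  linarith

/-- The reproducing property of the zonal functions of degree `k`. -/
theorem integral_unitZonal_mul_unitZonal (hd : 1 ≤ d) (k : ℕ) (ν μ : Sph d) :
    ∫ x : Sph d, (unitZonal d k).eval ⟪(x : EuclideanSpace ℝ (Fin (d + 1))), ν⟫ *
      (unitZonal d k).eval ⟪(x : EuclideanSpace ℝ (Fin (d + 1))), μ⟫ ∂surfaceMeasure d =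
    surfaceArea d / harmonicDim k d *
      (unitZonal d k).eval ⟪(ν : EuclideanSpace ℝ (Fin (d + 1))), μ⟫ := by
  set σ := surfaceMeasure d
  set Z := unitZonal d k
  -- The free pole ranges over the whole space, so that `G` can be evaluated along a curve of
  -- ambient vectors.
  let G : EuclideanSpace ℝ (Fin (d + 1)) → ℝ := fun y =>
    ∫ x : Sph d, Z.eval ⟪(x : EuclideanSpace ℝ (Fin (d + 1))), y⟫ *
      Z.eval ⟪(x : EuclideanSpace ℝ (Fin (d + 1))), μ⟫ ∂σ
  have hG : Continuous G := by
    have := continuous_parametric_integral_of_continuous (μ := σ)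
      (f := fun (y : EuclideanSpace ℝ (Fin (d + 1))) (x : Sph d) =>
        Z.eval ⟪(x : EuclideanSpace ℝ (Fin (d + 1))), y⟫ *
          Z.eval ⟪(x : EuclideanSpace ℝ (Fin (d + 1))), μ⟫)
      ((Z.continuous.comp (by fun_prop)).fun_mul (Z.continuous.comp (by fun_prop)))
      (isCompact_univ (X := Sph d))
    simpa only [Measure.restrict_univ] using this
  have hZ : 0 < surfaceArea d / harmonicDim k d := div_pos surfaceArea_pos (harmonicDim_pos hd k)
  have hGμ (x : Sph d) (hx : (x : EuclideanSpace ℝ (Fin (d + 1))) = μ) :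
      G x = surfaceArea d / harmonicDim k d := by
    rw [← zonalIntegral_unitZonal_sq hd μ k, hx, zonalIntegral_apply]
    simp only [eval_mul, G, Z, σ]
  obtain ⟨e, he1, heμ⟩ := exists_unit_inner_eq_zero hd μ
  have hzonal (y z : EuclideanSpace ℝ (Fin (d + 1))) (hyz : ‖y‖ = ‖z‖)
      (hμ : ⟪y, (μ : EuclideanSpace ℝ (Fin (d + 1)))⟫ = ⟪z, (μ : EuclideanSpace ℝ (Fin (d + 1)))⟫) :
      G y = G z := by
    -- This reflection exchanges `y` and `z` and fixes `μ`, since y - z is orthogonal to `μ`; hence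
    -- `G` is zonal.
    set L := (ℝ ∙ (y - z))ᗮ.reflection
    have hLy : L y = z := Submodule.reflection_sub hyz
    have hLμ : L μ = μ := by
      apply Submodule.reflection_mem_subspace_eq_self
      rw [Submodule.mem_orthogonal_singleton_iff_inner_right, inner_sub_left, hμ, sub_self]
    have h := integral_comp_sphereMap L (f := fun x : Sph d =>
      Z.eval ⟪(x : EuclideanSpace ℝ (Fin (d + 1))), z⟫ *
        Z.eval ⟪(x : EuclideanSpace ℝ (Fin (d + 1))), μ⟫)
      ((Z.continuous.comp (by fun_prop)).fun_mul (Z.continuous.comp (by fun_prop)))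
    refine Eq.trans ?_ h
    refine integral_congr_ae (Filter.Eventually.of_forall fun x => ?_)
    have h1 : ⟪L x, z⟫ = ⟪(x : EuclideanSpace ℝ (Fin (d + 1))), y⟫ := by
      rw [← hLy, L.inner_map_map]
    have h2 : ⟪L x, (μ : EuclideanSpace ℝ (Fin (d + 1)))⟫ =
        ⟪(x : EuclideanSpace ℝ (Fin (d + 1))), μ⟫ := by
      conv_lhs => rw [← hLμ]
      rw [L.inner_map_map]
    simp only [sphereMap, h1, h2]
  have hGc : Continuous fun x : Sph d => G x := hG.comp continuous_subtype_val
  have hZc := continuous_eval_inner_left Z μ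
  -- The projection coefficient on Z_k; its value is read off later at the pole `μ`.
  let c : ℝ := (∫ y : Sph d, G y * Z.eval ⟪(y : EuclideanSpace ℝ (Fin (d + 1))), μ⟫ ∂σ) /
    (surfaceArea d / harmonicDim k d)
  have hzero := eq_zero_of_integral_mul_unitZonal hd μ
    (F := fun y : Sph d => G y - c * Z.eval ⟪(y : EuclideanSpace ℝ (Fin (d + 1))), μ⟫)
    -- The profile of `G` along a meridian: for |s| ≤ 1 the argument is a unit vector at height s
    -- over `μ`.
    (g := fun s => G (s • (μ : EuclideanSpace ℝ (Fin (d + 1))) + √(1 - s ^ 2) • e) - c * Z.eval s)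
    (hGc.sub (continuous_const.mul hZc))
    ((hG.comp (by fun_prop)).sub (continuous_const.mul Z.continuous))
    (by
      intro y
      congr 1
      set s := ⟪(y : EuclideanSpace ℝ (Fin (d + 1))), μ⟫
      have hs : s ^ 2 ≤ 1 := (sq_le_one_iff_abs_le_one s).mpr (abs_inner_sphere_le_one y μ)
      have hμ1 := inner_self_sphere μ
      have hee : ⟪e, e⟫ = 1 := by rw [real_inner_self_eq_norm_sq, he1]; norm_num
      have hμe : ⟪(μ : EuclideanSpace ℝ (Fin (d + 1))), e⟫ = 0 := by rw [real_inner_comm, heμ]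
      apply hzonal
      · rw [norm_eq_of_mem_sphere, eq_comm, ← sq_eq_sq₀ (norm_nonneg _) zero_le_one,
          ← real_inner_self_eq_norm_sq]
        simp only [inner_add_left, inner_add_right, real_inner_smul_left, real_inner_smul_right,
          hμ1, hee, heμ, hμe]
        have := Real.mul_self_sqrt (sub_nonneg.mpr hs)
        linear_combination this
      · simp only [inner_add_left, real_inner_smul_left, heμ, hμ1]
        simp [s])
    (by
      intro j
      have hjc := continuous_eval_inner_left (unitZonal d j) μ
      simp only [sub_mul, mul_assoc]
      rw [integral_sub (hGc.fun_mul hjc).integrable_surfaceMeasure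
        (continuous_const.fun_mul (hZc.fun_mul hjc)).integrable_surfaceMeasure,
        integral_const_mul]
      by_cases hj : k = j
      · subst hj
        have := zonalIntegral_unitZonal_sq hd μ k
        simp only [zonalIntegral_apply, eval_mul] at this
        rw [this, div_mul_cancel₀ _ hZ.ne', sub_self]
      · rw [integral_unitZonal_mul_unitZonal_of_ne hd hj, mul_zero, sub_zero]
        simp only [G, ← integral_mul_const]
        -- After Fubini the inner integral over `y` pairs degrees k ≠ j with poles `x` and `μ`, so
        -- it vanishes.
        rw [integral_integral_swap_of_hasCompactSupport
          (f := fun (y x : Sph d) => Z.eval ⟪(x : EuclideanSpace ℝ (Fin (d + 1))), y⟫ *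
            Z.eval ⟪(x : EuclideanSpace ℝ (Fin (d + 1))), μ⟫ *
            (unitZonal d j).eval ⟪(y : EuclideanSpace ℝ (Fin (d + 1))), μ⟫)
          (((Z.continuous.comp (by fun_prop)).fun_mul (Z.continuous.comp (by fun_prop))).fun_mul
            ((unitZonal d j).continuous.comp (by fun_prop)))
          (HasCompactSupport.of_compactSpace _)]
        refine integral_eq_zero_of_ae (Filter.Eventually.of_forall fun x => ?_)
        have := integral_unitZonal_mul_unitZonal_of_ne hd hj x μ
        simp only [mul_right_comm _ (Z.eval ⟪(x : EuclideanSpace ℝ (Fin (d + 1))), μ⟫),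
          integral_mul_const]
        simp only [real_inner_comm _ (x : EuclideanSpace ℝ (Fin (d + 1)))] at this ⊢
        simp [Z, this])
  have hc : c = surfaceArea d / harmonicDim k d := by
    have := hzero μ
    rw [hGμ μ rfl, inner_self_sphere, unitZonal_eval_one hd] at this
    linarith
  have := hzero ν
  rw [hc, sub_eq_zero] at this
  exact this

/-- Cauchy–Schwarz for the reproducing formula, in the form |ab| ≤ (a² + b²)/2: both squared norms
equal ω/N_k, the factor in front of the value being bounded. -/
theorem abs_unitZonal_eval_inner_le_one (hd : 1 ≤ d) (k : ℕ) (ν μ : Sph d) :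
    |(unitZonal d k).eval ⟪(ν : EuclideanSpace ℝ (Fin (d + 1))), μ⟫| ≤ 1 := by
  have hZ : 0 < surfaceArea d / harmonicDim k d := div_pos surfaceArea_pos (harmonicDim_pos hd k)
  have h := integral_unitZonal_mul_unitZonal hd k
  have hc (μ : Sph d) := continuous_eval_inner_left (unitZonal d k) μ
  have hsq (μ : Sph d) := h μ μ
  simp only [inner_self_sphere, unitZonal_eval_one hd, mul_one] at hsq
  have h1 : |∫ x : Sph d, (unitZonal d k).eval ⟪(x : EuclideanSpace ℝ (Fin (d + 1))), ν⟫ *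
      (unitZonal d k).eval ⟪(x : EuclideanSpace ℝ (Fin (d + 1))), μ⟫ ∂surfaceMeasure d| ≤
      ∫ x : Sph d, ((unitZonal d k).eval ⟪(x : EuclideanSpace ℝ (Fin (d + 1))), ν⟫ *
          (unitZonal d k).eval ⟪(x : EuclideanSpace ℝ (Fin (d + 1))), ν⟫ +
        (unitZonal d k).eval ⟪(x : EuclideanSpace ℝ (Fin (d + 1))), μ⟫ *
          (unitZonal d k).eval ⟪(x : EuclideanSpace ℝ (Fin (d + 1))), μ⟫) / 2
        ∂surfaceMeasure d := by
    refine abs_integral_le_integral_abs.trans (integral_mono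
      ((hc ν).fun_mul (hc μ)).abs.integrable_surfaceMeasure
      (((hc ν).fun_mul (hc ν)).fun_add ((hc μ).fun_mul (hc μ))
        |>.div_const 2).integrable_surfaceMeasure fun x => ?_)
    dsimp only
    rw [abs_le]
    constructor <;> nlinarith [sq_nonneg ((unitZonal d k).eval
      ⟪(x : EuclideanSpace ℝ (Fin (d + 1))), ν⟫ - (unitZonal d k).eval
      ⟪(x : EuclideanSpace ℝ (Fin (d + 1))), μ⟫), sq_nonneg ((unitZonal d k).eval
      ⟪(x : EuclideanSpace ℝ (Fin (d + 1))), ν⟫ + (unitZonal d k).eval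
      ⟪(x : EuclideanSpace ℝ (Fin (d + 1))), μ⟫)]
  rw [h, integral_div, integral_add ((hc ν).fun_mul (hc ν)).integrable_surfaceMeasure
    ((hc μ).fun_mul (hc μ)).integrable_surfaceMeasure, hsq, hsq, add_self_div_two, abs_mul,
    abs_of_pos hZ] at h1
  exact le_of_mul_le_mul_left (by linarith) hZ

/-- The squared norm ω/N_k is at most ω because the zonal function is bounded by 1. -/
theorem one_le_harmonicDim (hd : 1 ≤ d) (k : ℕ) : 1 ≤ harmonicDim k d := by
  let μ : Sph d := ⟨EuclideanSpace.single 0 1, by simp⟩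
  have h := integral_unitZonal_mul_unitZonal hd k μ μ
  have hc := continuous_eval_inner_left (unitZonal d k) μ
  have hle : ∫ x : Sph d, (unitZonal d k).eval ⟪(x : EuclideanSpace ℝ (Fin (d + 1))), μ⟫ *
      (unitZonal d k).eval ⟪(x : EuclideanSpace ℝ (Fin (d + 1))), μ⟫ ∂surfaceMeasure d ≤
      ∫ _ : Sph d, (1 : ℝ) ∂surfaceMeasure d := by
    refine integral_mono (hc.fun_mul hc).integrable_surfaceMeasure (integrable_const 1) fun x => ?_
    have := abs_le.mp (abs_unitZonal_eval_inner_le_one hd k x μ)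
    dsimp only
    nlinarith
  rw [h, inner_self_sphere, unitZonal_eval_one hd, mul_one] at hle
  simp only [integral_const, smul_eq_mul, mul_one, surfaceMeasure_real_univ] at hle
  rw [div_le_iff₀ (harmonicDim_pos hd k)] at hle
  exact le_of_mul_le_mul_left (by linarith) (surfaceArea_pos (d := d))

end ReproducingKernel

/-! ### Cardioid densities, their products and mixtures. -/

section Cardioid

open Polynomial
open scoped RealInnerProductSpace

variable {d : ℕ}

theorem cardioidDensity_eq (hd : 1 ≤ d) (k : ℕ) (x μ : Sph d) (ρ : ℝ) :
    cardioidDensity d k x μ ρ = 1 / surfaceArea d *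
      (1 + ρ * (unitZonal d k).eval ⟪(x : EuclideanSpace ℝ (Fin (d + 1))), μ⟫) := by
  rw [cardioidDensity, zonalNormalized_eq hd]

theorem cardioidDensity_comm (k : ℕ) (x μ : Sph d) (ρ : ℝ) :
    cardioidDensity d k x μ ρ = cardioidDensity d k μ x ρ := by
  rw [cardioidDensity, cardioidDensity, real_inner_comm]

theorem cardioidDensity_nonneg (hd : 1 ≤ d) (k : ℕ) (x μ : Sph d) {ρ : ℝ}
    (hρ : ρ ∈ Set.Icc (-1 : ℝ) 1) : 0 ≤ cardioidDensity d k x μ ρ := by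
  rw [cardioidDensity_eq hd]
  refine mul_nonneg (one_div_nonneg.mpr surfaceArea_pos.le) ?_
  have h : |ρ * (unitZonal d k).eval ⟪(x : EuclideanSpace ℝ (Fin (d + 1))), μ⟫| ≤ 1 := by
    rw [abs_mul]
    exact mul_le_one₀ (abs_le.mpr hρ) (abs_nonneg _) (abs_unitZonal_eval_inner_le_one hd k x μ)
  linarith [(abs_le.mp h).1]

theorem continuous_cardioidDensity_left (k : ℕ) (μ : Sph d) (ρ : ℝ) :
    Continuous fun x : Sph d => cardioidDensity d k x μ ρ :=
  continuous_const.fun_mul (continuous_const.add (continuous_const.mul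
    ((continuous_eval_inner_left (zonalPoly d k) μ).div_const _)))

theorem integral_unitZonal (hd : 1 ≤ d) {k : ℕ} (hk : 1 ≤ k) (μ : Sph d) :
    ∫ x : Sph d, (unitZonal d k).eval ⟪(x : EuclideanSpace ℝ (Fin (d + 1))), μ⟫
      ∂surfaceMeasure d = 0 := by
  simpa [unitZonal] using
    integral_unitZonal_mul_unitZonal_of_ne hd (j := k) (k := 0) (by omega) μ μ

theorem integral_cardioidDensity (hd : 1 ≤ d) {k : ℕ} (hk : 1 ≤ k) (μ : Sph d) (ρ : ℝ) :
    ∫ x, cardioidDensity d k x μ ρ ∂surfaceMeasure d = 1 := by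
  simp only [cardioidDensity_eq hd]
  rw [integral_const_mul, integral_add (integrable_const _)
    (continuous_const.fun_mul (continuous_eval_inner_left _ μ)).integrable_surfaceMeasure,
    integral_const_mul, integral_unitZonal hd hk]
  simp [surfaceMeasure_real_univ, (surfaceArea_pos (d := d)).ne']

theorem integrable_cardioidDensity_mul (k₁ k₂ : ℕ) (μ₁ μ₂ : Sph d) (ρ₁ ρ₂ : ℝ) :
    Integrable (fun x => cardioidDensity d k₁ x μ₁ ρ₁ * cardioidDensity d k₂ x μ₂ ρ₂)
      (surfaceMeasure d) :=
  ((continuous_cardioidDensity_left k₁ μ₁ ρ₁).fun_mul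
    (continuous_cardioidDensity_left k₂ μ₂ ρ₂)).integrable_surfaceMeasure

theorem integral_unitZonal_mul_unitZonal_eq_kronecker (hd : 1 ≤ d) (k₁ k₂ : ℕ) (μ₁ μ₂ : Sph d) :
    ∫ x : Sph d, (unitZonal d k₁).eval ⟪(x : EuclideanSpace ℝ (Fin (d + 1))), μ₁⟫ *
      (unitZonal d k₂).eval ⟪(x : EuclideanSpace ℝ (Fin (d + 1))), μ₂⟫ ∂surfaceMeasure d =
    kronecker k₁ k₂ * (surfaceArea d / harmonicDim k₁ d *
      (unitZonal d k₁).eval ⟪(μ₁ : EuclideanSpace ℝ (Fin (d + 1))), μ₂⟫) := by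
  by_cases h : k₁ = k₂
  · subst h
    rw [integral_unitZonal_mul_unitZonal hd, kronecker, if_pos rfl, one_mul]
  · rw [integral_unitZonal_mul_unitZonal_of_ne hd h, kronecker, if_neg h, zero_mul]

theorem integral_cardioidDensity_mul (hd : 1 ≤ d) {k₁ k₂ : ℕ} (hk₁ : 1 ≤ k₁) (hk₂ : 1 ≤ k₂)
    (ρ₁ ρ₂ : ℝ) (μ₁ μ₂ : Sph d) :
    ∫ x, cardioidDensity d k₁ x μ₁ ρ₁ * cardioidDensity d k₂ x μ₂ ρ₂ ∂(surfaceMeasure d) =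
      cardioidDensity d k₁ μ₁ μ₂ (kronecker k₁ k₂ * (ρ₁ * ρ₂ / harmonicDim k₁ d)) := by
  have hω := (surfaceArea_pos (d := d)).ne'
  have c₁ := continuous_eval_inner_left (unitZonal d k₁) μ₁
  have c₂ := continuous_eval_inner_left (unitZonal d k₂) μ₂
  simp only [cardioidDensity_eq hd]
  have e : ∀ x : Sph d, 1 / surfaceArea d *
      (1 + ρ₁ * (unitZonal d k₁).eval ⟪(x : EuclideanSpace ℝ (Fin (d + 1))), μ₁⟫) *
      (1 / surfaceArea d *
      (1 + ρ₂ * (unitZonal d k₂).eval ⟪(x : EuclideanSpace ℝ (Fin (d + 1))), μ₂⟫)) =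
      (1 / surfaceArea d) ^ 2 *
      (1 + ρ₁ * (unitZonal d k₁).eval ⟪(x : EuclideanSpace ℝ (Fin (d + 1))), μ₁⟫ +
        ρ₂ * (unitZonal d k₂).eval ⟪(x : EuclideanSpace ℝ (Fin (d + 1))), μ₂⟫ +
        ρ₁ * ρ₂ * ((unitZonal d k₁).eval ⟪(x : EuclideanSpace ℝ (Fin (d + 1))), μ₁⟫ *
          (unitZonal d k₂).eval ⟪(x : EuclideanSpace ℝ (Fin (d + 1))), μ₂⟫)) :=
    fun x => by ring
  simp only [e]
  rw [integral_const_mul,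
    integral_add (Continuous.integrable_surfaceMeasure (by fun_prop))
      (Continuous.integrable_surfaceMeasure (by fun_prop)),
    integral_add (Continuous.integrable_surfaceMeasure (by fun_prop))
      (Continuous.integrable_surfaceMeasure (by fun_prop)),
    integral_add (Continuous.integrable_surfaceMeasure (by fun_prop))
      (Continuous.integrable_surfaceMeasure (by fun_prop)),
    integral_const_mul, integral_const_mul, integral_const_mul, integral_unitZonal hd hk₁,
    integral_unitZonal hd hk₂, integral_unitZonal_mul_unitZonal_eq_kronecker hd]
  simp only [integral_const, smul_eq_mul, surfaceMeasure_real_univ]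
  field_simp
  ring

theorem kronecker_mul_div_harmonicDim_mem_Icc (hd : 1 ≤ d) (k₁ k₂ : ℕ) {ρ₁ ρ₂ : ℝ}
    (hρ₁ : ρ₁ ∈ Set.Icc (-1 : ℝ) 1) (hρ₂ : ρ₂ ∈ Set.Icc (-1 : ℝ) 1) :
    kronecker k₁ k₂ * (ρ₁ * ρ₂ / harmonicDim k₁ d) ∈ Set.Icc (-1 : ℝ) 1 := by
  have h : |ρ₁ * ρ₂ / harmonicDim k₁ d| ≤ 1 := by
    rw [abs_div, abs_mul, abs_of_pos (harmonicDim_pos hd k₁)]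
    exact div_le_one_of_le₀ ((mul_le_one₀ (abs_le.mpr hρ₁) (abs_nonneg _)
      (abs_le.mpr hρ₂)).trans (one_le_harmonicDim hd k₁)) (harmonicDim_pos hd k₁).le
  unfold kronecker
  split_ifs
  · rw [one_mul]; exact abs_le.mp h
  · simp

theorem isMarkovKernel_cardioidKernel (hd : 1 ≤ d) {k : ℕ} (hk : 1 ≤ k) {ρ : ℝ}
    (hρ : ρ ∈ Set.Icc (-1 : ℝ) 1) : IsMarkovKernel (cardioidKernel d k ρ) := by
  refine ⟨fun ξ => ⟨?_⟩⟩
  change (surfaceMeasure d).withDensity _ Set.univ = 1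
  rw [withDensity_apply _ MeasurableSet.univ, Measure.restrict_univ,
    ← ofReal_integral_eq_lintegral_ofReal
      (continuous_cardioidDensity_left k ξ ρ).integrable_surfaceMeasure
      (Filter.Eventually.of_forall fun x => cardioidDensity_nonneg hd k x ξ hρ),
    integral_cardioidDensity hd hk, ENNReal.ofReal_one]

/-- The mixture of the distributions `C_{k₁}(ξ, ρ₁)` over `ξ ∼ C_{k₂}(μ₂, ρ₂)`. -/
theorem cardioid_bind_cardioidKernel (hd : 1 ≤ d) {k₁ k₂ : ℕ} (hk₁ : 1 ≤ k₁) (hk₂ : 1 ≤ k₂)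
    {ρ₁ ρ₂ : ℝ} (hρ₁ : ρ₁ ∈ Set.Icc (-1 : ℝ) 1) (hρ₂ : ρ₂ ∈ Set.Icc (-1 : ℝ) 1) (μ₂ : Sph d) :
    (cardioid d k₂ μ₂ ρ₂).bind (cardioidKernel d k₁ ρ₁) =
      cardioid d k₁ μ₂ (kronecker k₁ k₂ * (ρ₁ * ρ₂ / harmonicDim k₁ d)) := by
  ext s hs
  have hm₂ : Measurable fun ξ : Sph d => ENNReal.ofReal (cardioidDensity d k₂ ξ μ₂ ρ₂) :=
    (continuous_cardioidDensity_left k₂ μ₂ ρ₂).measurable.ennreal_ofReal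
  have hm₁ : Measurable fun p : Sph d × Sph d =>
      ENNReal.ofReal (cardioidDensity d k₁ p.2 p.1 ρ₁) :=
    (continuous_cardioidDensity d k₁ ρ₁).measurable.ennreal_ofReal
  rw [Measure.bind_apply hs (Kernel.aemeasurable _), cardioid,
    lintegral_withDensity_eq_lintegral_mul _ hm₂ (Kernel.measurable_coe _ hs), cardioid,
    withDensity_apply _ hs]
  have h1 : ∀ ξ : Sph d, ((fun ξ => ENNReal.ofReal (cardioidDensity d k₂ ξ μ₂ ρ₂)) *
      fun ξ => cardioidKernel d k₁ ρ₁ ξ s) ξ =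
      ∫⁻ x in s, ENNReal.ofReal (cardioidDensity d k₂ ξ μ₂ ρ₂) *
        ENNReal.ofReal (cardioidDensity d k₁ x ξ ρ₁) ∂surfaceMeasure d := by
    intro ξ
    have hx : Measurable fun x : Sph d => ENNReal.ofReal (cardioidDensity d k₁ x ξ ρ₁) :=
      (continuous_cardioidDensity_left k₁ ξ ρ₁).measurable.ennreal_ofReal
    rw [lintegral_const_mul _ hx, ← withDensity_apply _ hs]
    rfl
  simp only [h1]
  rw [lintegral_lintegral_swap ((hm₂.comp measurable_fst).mul hm₁).aemeasurable]
  refine lintegral_congr fun x => ?_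
  -- The product formula is used with poles `x` and `μ₂`; symmetry of the density turns the mean
  -- direction `ξ` into the integration variable.
  rw [← integral_cardioidDensity_mul hd hk₁ hk₂, ofReal_integral_eq_lintegral_ofReal
    (integrable_cardioidDensity_mul k₁ k₂ x μ₂ ρ₁ ρ₂) (Filter.Eventually.of_forall fun ξ =>
      mul_nonneg (cardioidDensity_nonneg hd k₁ ξ x hρ₁) (cardioidDensity_nonneg hd k₂ ξ μ₂ hρ₂))]
  refine lintegral_congr fun ξ => ?_
  rw [ENNReal.ofReal_mul (cardioidDensity_nonneg hd k₁ ξ x hρ₁), mul_comm,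
    cardioidDensity_comm k₁ x ξ]

end Cardioid

theorem proposition1 (d : ℕ) (hd : 1 ≤ d) (k₁ k₂ : ℕ) (hk₁ : 1 ≤ k₁) (hk₂ : 1 ≤ k₂)
    (ρ₁ ρ₂ : ℝ) (hρ₁ : ρ₁ ∈ Set.Icc (-1 : ℝ) 1) (hρ₂ : ρ₂ ∈ Set.Icc (-1 : ℝ) 1)
    (μ₁ μ₂ : Sph d) :
    (Integrable (fun x => cardioidDensity d k₁ x μ₁ ρ₁ * cardioidDensity d k₂ x μ₂ ρ₂)
        (surfaceMeasure d) ∧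
      ∫ x, cardioidDensity d k₁ x μ₁ ρ₁ * cardioidDensity d k₂ x μ₂ ρ₂ ∂(surfaceMeasure d) =
        cardioidDensity d k₁ μ₁ μ₂ (kronecker k₁ k₂ * (ρ₁ * ρ₂ / harmonicDim k₁ d))) ∧
    kronecker k₁ k₂ * (ρ₁ * ρ₂ / harmonicDim k₁ d) ∈ Set.Icc (-1 : ℝ) 1 ∧
    ∀ {Ω : Type*} [MeasurableSpace Ω] (P : Measure Ω) [IsProbabilityMeasure P] (X Ξ : Ω → Sph d),
      HasCondDistrib X Ξ (cardioidKernel d k₁ ρ₁) P →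
      HasLaw Ξ (cardioid d k₂ μ₂ ρ₂) P →
      HasLaw X (cardioid d k₁ μ₂ (kronecker k₁ k₂ * (ρ₁ * ρ₂ / harmonicDim k₁ d))) P := by
  refine ⟨⟨integrable_cardioidDensity_mul k₁ k₂ μ₁ μ₂ ρ₁ ρ₂,
    integral_cardioidDensity_mul hd hk₁ hk₂ ρ₁ ρ₂ μ₁ μ₂⟩,
    kronecker_mul_div_harmonicDim_mem_Icc hd k₁ k₂ hρ₁ hρ₂, ?_⟩
  intro Ω _ P _ X Ξ hX hΞ
  have := isMarkovKernel_cardioidKernel hd hk₁ hρ₁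
  refine ⟨hX.aemeasurable_snd, ?_⟩
  -- The law of `X` is the second marginal of the joint law of `Ξ` and `X`, that is, the mixture of
  -- the kernel over the law of `Ξ`.
  rw [← Measure.snd_map_prodMk₀ hX.aemeasurable_fst, hX.map_eq, Measure.snd_compProd, hΞ.map_eq,
    cardioid_bind_cardioidKernel hd hk₁ hk₂ hρ₁ hρ₂]
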